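/- Let $a\le b$ be real numbers, let $y:[a,b]\to\mathbb{R}$ be a Lipschitz function, and let $\gamma=\{\gamma(t)=t+iy(t) : t\in[a,b]\}\subset\mathbb{C}$ be its graph, with arc length element $ds$, i.e. $\int_\gamma h\,ds=\int_a^b h(\gamma(t))\sqrt{1+y'(t)^2}\,dt$. Let $\varphi:\gamma\to[-\infty,\infty]$ be measurable (with respect to arc length) with $\int_\gamma e^{-\varphi}\,ds<\infty$. Let $L^2(\gamma,\varphi)$ be the space of (classes of) measurable functions $f:\gamma\to\mathbb{C}$ with $\|f\|^2_{L^2(\gamma,\varphi)}=\int_\gamma |f|^2e^{-\varphi}\,ds<\infty$. Then every polynomial $P\in\mathbb{C}[z]$ belongs to $L^2(\gamma,\varphi)$, and the polynomials in $z$ are dense in $L^2(\gamma,\varphi)$. -/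

import Mathlib

open MeasureTheory Set
open scoped NNReal ENNReal Polynomial

/-- The parametrization `γ(t) = t + i y(t)` of the graph of `y`. -/
noncomputable def graphParam (y : ℝ → ℝ) (t : ℝ) : ℂ := ⟨t, y t⟩

/-- The arc length measure `ds` on the graph `γ` of `y` over `[a, b]`, as a Borel measure on `ℂ`:
the image under `γ(t) = t + i y(t)` of the measure `|γ'(t)| dt = √(1 + y'(t)²) dt` on `[a, b]`, so
that `∫_γ h ds = ∫_a^b h(γ(t)) |γ'(t)| dt`. -/
noncomputable def arcLengthMeasure (y : ℝ → ℝ) (a b : ℝ) : Measure ℂ :=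
  ((volume.restrict (Icc a b)).withDensity
    (fun t => ENNReal.ofReal (Real.sqrt (1 + deriv y t ^ 2)))).map (graphParam y)

/-- The weight `e^{-φ}` with values in `[0, ∞]`, for an extended real valued `φ`
(`e^{-φ} = ∞` where `φ = -∞`, and `e^{-φ} = 0` where `φ = +∞`). -/
noncomputable def expNeg (φ : ℂ → EReal) (z : ℂ) : ℝ≥0∞ := EReal.exp (-φ z)

/-- The measure `e^{-φ} ds` on the graph of `y` over `[a, b]`. The weighted space `L²(γ, φ)` is
`Lp ℂ 2 (weightedArcMeasure y a b φ)`. -/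
noncomputable def weightedArcMeasure (y : ℝ → ℝ) (a b : ℝ) (φ : ℂ → EReal) : Measure ℂ :=
  (arcLengthMeasure y a b).withDensity (expNeg φ)

/-! By Hilbert space duality it suffices that an `f` in `L²(μ)` orthogonal to all polynomials is
zero. The measure `conj f dμ` then has vanishing moments, so its Cauchy transform is zero near
infinity. Extend `y` to a continuous `Y` on `ℝ`: both components of the complement of its graph are
unbounded, so the identity theorem makes the transform vanish off the graph
(`cauchyTransform_eq_zero_off_graph`), hence almost everywhere in the plane. By Cauchy–Pompeiu
(`integral_twoDbar_div_sub`) and Fubini, `conj f dμ` annihilates every test function, so `f = 0`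
(`ae_eq_zero_of_moments_eq_zero`). -/

/-! ### The Cauchy–Pompeiu formula in polar coordinates. -/

/-- Twice the Wirtinger derivative `∂g/∂z̄` of a real valued function `g`. -/
noncomputable def twoDbar (g : ℂ → ℝ) (z : ℂ) : ℂ :=
  fderiv ℝ g z 1 + Complex.I * fderiv ℝ g z Complex.I

theorem continuous_twoDbar {g : ℂ → ℝ} (hg : ContDiff ℝ 1 g) : Continuous (twoDbar g) := by
  have h := hg.continuous_fderiv one_ne_zero
  unfold twoDbar
  fun_prop

/-- Passing from the frame `1, i` to `u, iu` with `u = c + is` multiplies `2∂/∂z̄` by the conjugate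
of `u`. -/
theorem twoDbar_mul_conj (g : ℂ → ℝ) (z : ℂ) (c s : ℝ) :
    twoDbar g z * (c - s * Complex.I) =
      fderiv ℝ g z (c + s * Complex.I) +
        Complex.I * fderiv ℝ g z (Complex.I * (c + s * Complex.I)) := by
  have h1 : (c + s * Complex.I : ℂ) = c • (1 : ℂ) + s • Complex.I := by simp
  have h2 : Complex.I * (c + s * Complex.I : ℂ) = c • Complex.I + (-s) • (1 : ℂ) := by
    simp only [Complex.real_smul, Complex.ofReal_neg]
    linear_combination (s : ℂ) * Complex.I_mul_I
  rw [h2, h1, map_add, map_add, map_smul, map_smul, map_smul, map_smul, twoDbar]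
  simp only [smul_eq_mul]
  push_cast
  linear_combination (-(fderiv ℝ g z Complex.I : ℂ) * s) * Complex.I_mul_I

/-- The unit vector `e^{iθ}`. -/
noncomputable def unitVec (θ : ℝ) : ℂ := Real.cos θ + Real.sin θ * Complex.I

theorem continuous_unitVec : Continuous unitVec := by
  unfold unitVec
  fun_prop

theorem hasDerivAt_unitVec (θ : ℝ) : HasDerivAt unitVec (Complex.I * unitVec θ) θ := by
  have h := (Real.hasDerivAt_cos θ).ofReal_comp.add
    ((Real.hasDerivAt_sin θ).ofReal_comp.mul_const Complex.I)
  convert! h using 1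
  rw [unitVec, Complex.ofReal_neg]
  linear_combination (Real.sin θ : ℂ) * Complex.I_mul_I

theorem norm_unitVec (θ : ℝ) : ‖unitVec θ‖ = 1 := by
  simp [unitVec, Complex.norm_cos_add_sin_mul_I]

theorem unitVec_mul_conj (θ : ℝ) :
    unitVec θ * (Real.cos θ - Real.sin θ * Complex.I) = 1 := by
  have h : (Real.cos θ : ℂ) ^ 2 + (Real.sin θ : ℂ) ^ 2 = 1 := by
    exact_mod_cast Real.cos_sq_add_sin_sq θ
  unfold unitVec
  linear_combination h - (Real.sin θ : ℂ) ^ 2 * Complex.I_mul_I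

/-- The polar Jacobian cancels the pole, leaving a radial derivative plus `i` times a tangential
one. -/
theorem polar_twoDbar_div (g : ℂ → ℝ) {r : ℝ} (hr : 0 < r) (θ : ℝ) :
    r • (twoDbar g (r * unitVec θ) / (r * unitVec θ)) =
      (fderiv ℝ g (r * unitVec θ) (unitVec θ) : ℂ) +
        Complex.I * fderiv ℝ g (r * unitVec θ) (Complex.I * unitVec θ) := by
  have h := twoDbar_mul_conj g (r * unitVec θ) (Real.cos θ) (Real.sin θ)
  rw [show (Real.cos θ + Real.sin θ * Complex.I : ℂ) = unitVec θ from rfl] at h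
  rw [← h, Complex.real_smul]
  have hr' : (r : ℂ) ≠ 0 := by exact_mod_cast hr.ne'
  have hu : unitVec θ ≠ 0 := by
    rw [← norm_ne_zero_iff, norm_unitVec]; exact one_ne_zero
  rw [mul_div_assoc', div_eq_iff (mul_ne_zero hr' hu)]
  linear_combination (-(twoDbar g (r * unitVec θ)) * r) * unitVec_mul_conj θ

theorem exists_fderiv_eq_zero_of_lt_norm {g : ℂ → ℝ} (hs : HasCompactSupport g) :
    ∃ R : ℝ, 0 < R ∧ ∀ z, R < ‖z‖ → g z = 0 ∧ fderiv ℝ g z = 0 := by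
  obtain ⟨R, hR0, hR⟩ := hs.isBounded.exists_pos_norm_le
  refine ⟨R, hR0, fun z hz => ?_⟩
  have hz' : z ∉ tsupport g := fun h => absurd (hR z h) (not_le.2 hz)
  exact ⟨image_eq_zero_of_notMem_tsupport hz',
    image_eq_zero_of_notMem_tsupport fun h => hz' (tsupport_fderiv_subset ℝ h)⟩

theorem integrable_polar_of_continuous {F : ℝ × ℝ → ℝ} (hF : Continuous F) {R : ℝ}
    (hR : ∀ p : ℝ × ℝ, R < p.1 → F p = 0) :
    Integrable F ((volume.restrict (Ioi (0 : ℝ))).prod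
      (volume.restrict (Ioo (-Real.pi) Real.pi))) := by
  rw [Measure.prod_restrict]
  refine IntegrableOn.of_forall_sdiff_eq_zero (s := Icc 0 R ×ˢ Icc (-Real.pi) Real.pi)
    (hF.continuousOn.integrableOn_compact (isCompact_Icc.prod isCompact_Icc))
    (measurableSet_Ioi.prod measurableSet_Ioo) fun p hp => hR p ?_
  by_contra! h
  exact hp.2 ⟨⟨hp.1.1.le, h⟩, Ioo_subset_Icc_self hp.1.2⟩

theorem integral_radial_fderiv {g : ℂ → ℝ} (hg : ContDiff ℝ 1 g) (hs : HasCompactSupport g)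
    (θ : ℝ) : ∫ r in Ioi (0 : ℝ), fderiv ℝ g (r * unitVec θ) (unitVec θ) = -g 0 := by
  obtain ⟨R, -, hR⟩ := exists_fderiv_eq_zero_of_lt_norm hs
  have hd : ∀ r : ℝ, HasDerivAt (fun r : ℝ => g (r * unitVec θ))
      (fderiv ℝ g (r * unitVec θ) (unitVec θ)) r := fun r => by
    have h1 : HasDerivAt (fun r : ℝ => (r : ℂ) * unitVec θ) (unitVec θ) r := by
      simpa using (HasDerivAt.ofReal_comp (hasDerivAt_id r)).mul_const (unitVec θ)
    exact ((hg.differentiable one_ne_zero) _).hasFDerivAt.comp_hasDerivAt r h1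
  have hc : HasCompactSupport fun r : ℝ => g (r * unitVec θ) := by
    refine HasCompactSupport.intro (isCompact_Icc (a := -R) (b := R)) fun r hr => (hR _ ?_).1
    rw [norm_mul, norm_unitVec, mul_one, Complex.norm_real, Real.norm_eq_abs]
    by_contra! h
    exact hr (abs_le.1 h)
  have hcd : ContDiff ℝ 1 fun r : ℝ => g (r * unitVec θ) :=
    hg.comp (Complex.ofRealCLM.contDiff.mul contDiff_const)
  have h := hc.integral_Ioi_deriv_eq hcd 0
  simp only [fun r => (hd r).deriv] at h
  simpa using h

/-- Up to the factor `r`, the integrand is the derivative in `θ` of a `2π`-periodic function. -/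
theorem integral_angular_fderiv {g : ℂ → ℝ} (hg : ContDiff ℝ 1 g) {r : ℝ} (hr : 0 < r) :
    ∫ θ in Ioo (-Real.pi) Real.pi,
      fderiv ℝ g (r * unitVec θ) (Complex.I * unitVec θ) = 0 := by
  have hd : ∀ θ : ℝ, HasDerivAt (fun θ : ℝ => g (r * unitVec θ))
      (r * fderiv ℝ g (r * unitVec θ) (Complex.I * unitVec θ)) θ := fun θ => by
    have h1 := (hasDerivAt_unitVec θ).const_mul (r : ℂ)
    have h2 := ((hg.differentiable one_ne_zero) (r * unitVec θ)).hasFDerivAt.comp_hasDerivAt θ h1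
    convert! h2 using 1
    rw [← Complex.real_smul (x := r) (z := Complex.I * _), map_smul, smul_eq_mul]
  have hcont : Continuous fun θ : ℝ =>
      r * fderiv ℝ g (r * unitVec θ) (Complex.I * unitVec θ) := by
    have := hg.continuous_fderiv one_ne_zero
    have := continuous_unitVec
    fun_prop
  have h := intervalIntegral.integral_eq_sub_of_hasDerivAt (fun θ _ => hd θ)
    (hcont.intervalIntegrable (-Real.pi) Real.pi)
  have hpi : unitVec (-Real.pi) = unitVec Real.pi := by simp [unitVec]
  rw [hpi, sub_self, intervalIntegral.integral_const_mul, intervalIntegral.integral_of_le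
    (by linarith [Real.pi_pos]), integral_Ioc_eq_integral_Ioo] at h
  exact (mul_eq_zero.1 h).resolve_left hr.ne'

theorem integral_twoDbar_div {g : ℂ → ℝ} (hg : ContDiff ℝ 1 g) (hs : HasCompactSupport g) :
    ∫ z, twoDbar g z / z = -(2 * Real.pi * g 0 : ℝ) := by
  obtain ⟨R, -, hR⟩ := exists_fderiv_eq_zero_of_lt_norm hs
  have hcf := hg.continuous_fderiv one_ne_zero
  have hcu := continuous_unitVec
  have hzero : ∀ p : ℝ × ℝ, R < p.1 → fderiv ℝ g (p.1 * unitVec p.2) = 0 := fun p hp => by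
    refine (hR _ ?_).2
    rw [norm_mul, norm_unitVec, mul_one, Complex.norm_real]
    exact hp.trans_le (le_abs_self _)
  set A : ℝ × ℝ → ℝ := fun p => fderiv ℝ g (p.1 * unitVec p.2) (unitVec p.2) with hA
  set B : ℝ × ℝ → ℝ :=
    fun p => fderiv ℝ g (p.1 * unitVec p.2) (Complex.I * unitVec p.2) with hB
  have hAi := integrable_polar_of_continuous (F := A) (by fun_prop) (R := R)
    fun p hp => by simp [hA, hzero p hp]
  have hBi := integrable_polar_of_continuous (F := B) (by fun_prop) (R := R)
    fun p hp => by simp [hB, hzero p hp]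
  have hAint : ∫ p, A p ∂((volume.restrict (Ioi (0 : ℝ))).prod
      (volume.restrict (Ioo (-Real.pi) Real.pi))) = -(2 * Real.pi * g 0) := by
    -- The radial term is integrated in `r` first, the angular term below in `θ` first, so each
    -- inner integral is that of an exact derivative.
    rw [integral_prod_symm _ hAi]
    simp only [hA, integral_radial_fderiv hg hs]
    rw [setIntegral_const]
    rw [Real.volume_real_Ioo_of_le (by linarith [Real.pi_pos]), smul_eq_mul]
    ring
  have hBint : ∫ p, B p ∂((volume.restrict (Ioi (0 : ℝ))).prod
      (volume.restrict (Ioo (-Real.pi) Real.pi))) = 0 := by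
    rw [integral_prod _ hBi]
    exact setIntegral_eq_zero_of_forall_eq_zero fun r hr => integral_angular_fderiv hg hr
  rw [← Complex.integral_comp_polarCoord_symm]
  have hcongr : ∫ p in polarCoord.target, p.1 • (twoDbar g (Complex.polarCoord.symm p) /
      Complex.polarCoord.symm p) = ∫ p in polarCoord.target, ((A p : ℂ) + Complex.I * B p) := by
    refine setIntegral_congr_fun polarCoord.open_target.measurableSet fun p hp => ?_
    rw [polarCoord_target] at hp
    simp only [Complex.polarCoord_symm_apply]
    exact polar_twoDbar_div g hp.1 p.2
  rw [hcongr, polarCoord_target, Measure.volume_eq_prod, ← Measure.prod_restrict,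
    integral_add hAi.ofReal (hBi.ofReal.const_mul _), integral_const_mul,
    integral_complex_ofReal, integral_complex_ofReal, hAint, hBint]
  push_cast
  ring

/-- The **Cauchy–Pompeiu formula** for compactly supported functions. -/
theorem integral_twoDbar_div_sub {g : ℂ → ℝ} (hg : ContDiff ℝ 1 g) (hs : HasCompactSupport g)
    (w : ℂ) : ∫ z, twoDbar g z / (z - w) = -(2 * Real.pi * g w : ℝ) := by
  have h := integral_twoDbar_div (g := fun z => g (z + w)) (hg.comp (contDiff_id.add contDiff_const))
    (hs.comp_homeomorph (Homeomorph.addRight w))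
  have hd : ∀ z, twoDbar (fun z => g (z + w)) z = twoDbar g (z + w) := fun z => by
    simp only [twoDbar, fderiv_comp_add_right]
  simp only [hd, zero_add] at h
  rw [← h, ← integral_add_right_eq_self _ w]
  simp

/-- In the plane the Jacobian `r` offsets the singularity; this is what permits Fubini for the
Cauchy kernel. -/
theorem integrableOn_inv_norm_closedBall (R : ℝ) :
    IntegrableOn (fun z : ℂ => ‖z‖⁻¹) (Metric.closedBall 0 R) := by
  refine IntegrableOn.mono_set ?_ (Metric.closedBall_subset_ball (lt_add_one R))
  rw [integrableOn_fun_norm_addHaar volume (f := fun r => r⁻¹), Complex.finrank_real_complex]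
  refine (integrableOn_const (C := (1 : ℝ)) (by simp)).congr_fun (fun r hr => ?_) measurableSet_Ioo
  simp [hr.1.ne']

/-! ### Vanishing of the Cauchy transform off the graph. -/

section CauchyTransform

open Filter Topology

/-- The Cauchy transform of the complex measure `h μ`. -/
noncomputable def cauchyTransform (μ : Measure ℂ) (h : ℂ → ℂ) (z : ℂ) : ℂ :=
  ∫ w, h w / (w - z) ∂μ

/-- For `|w| ≤ R < |z|` one has `1/(w - z) = -∑ wⁿ/zⁿ⁺¹`, and termwise integration produces only
moments. -/
theorem cauchyTransform_eq_zero_of_lt_norm {μ : Measure ℂ} {h : ℂ → ℂ} (hh : Integrable h μ)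
    {R : ℝ} (hR : ∀ᵐ w ∂μ, ‖w‖ ≤ R) (hmom : ∀ n : ℕ, ∫ w, h w * w ^ n ∂μ = 0) {z : ℂ}
    (hR0 : 0 ≤ R) (hz : R < ‖z‖) : cauchyTransform μ h z = 0 := by
  have hz0 : 0 < ‖z‖ := hR0.trans_lt hz
  have hzne : z ≠ 0 := norm_pos_iff.1 hz0
  set F : ℕ → ℂ → ℂ := fun n w => h w * w ^ n * -(z ^ (n + 1))⁻¹ with hF
  have hbound : ∀ n, ∀ᵐ w ∂μ, ‖F n w‖ ≤ ‖h w‖ * ((R / ‖z‖) ^ n * ‖z‖⁻¹) := fun n => by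
    filter_upwards [hR] with w hw
    have h1 : ‖F n w‖ = ‖h w‖ * ((‖w‖ / ‖z‖) ^ n * ‖z‖⁻¹) := by
      simp only [hF, norm_mul, norm_neg, norm_inv, norm_pow, div_pow, pow_succ]
      field_simp
    rw [h1]
    gcongr
  have hFint : ∀ n, Integrable (F n) μ := fun n => by
    refine (hh.norm.mul_const _).mono' ?_ (hbound n)
    exact (hh.aestronglyMeasurable.mul (by fun_prop)).mul_const _
  have hsum : Summable fun n => ∫ w, ‖F n w‖ ∂μ := by
    refine Summable.of_nonneg_of_le (fun n => integral_nonneg fun w => norm_nonneg _)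
      (fun n => (integral_mono_ae (hFint n).norm (hh.norm.mul_const _) (hbound n)).trans_eq
        (integral_mul_const _ _)) ?_
    exact (((summable_geometric_of_lt_one (by positivity)
      ((div_lt_one hz0).2 hz)).mul_right _).mul_left _)
  have hs := hasSum_integral_of_summable_integral_norm hFint hsum
  have hzero : ∀ n, ∫ w, F n w ∂μ = 0 := fun n => by
    simp only [hF]
    rw [integral_mul_const, hmom, zero_mul]
  simp only [hzero] at hs
  rw [hasSum_zero.unique hs]
  refine integral_congr_ae ?_
  filter_upwards [hR] with w hw
  have hlt : ‖w / z‖ < 1 := by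
    rw [norm_div, div_lt_one hz0]
    exact hw.trans_lt hz
  have hg := (hasSum_geometric_of_norm_lt_one hlt).mul_left (-(h w / z))
  have hne : w - z ≠ 0 := fun h0 => (hw.trans_lt hz).ne (by rw [sub_eq_zero.1 h0])
  have hne' : z - w ≠ 0 := fun h0 => hne (by rw [← neg_sub, h0, neg_zero])
  have hval : -(h w / z) * (1 - w / z)⁻¹ = h w / (w - z) := by
    rw [one_sub_div hzne, inv_div, ← neg_sub z w]
    field_simp
  rw [hval] at hg
  refine hg.tsum_eq.symm.trans (tsum_congr fun n => ?_)
  simp only [hF, div_pow, pow_succ]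
  field_simp

theorem differentiableAt_cauchyTransform {μ : Measure ℂ} {h : ℂ → ℂ} (hh : Integrable h μ)
    {K : Set ℂ} (hK : IsClosed K) (hμK : ∀ᵐ w ∂μ, w ∈ K) {z : ℂ} (hz : z ∉ K) :
    DifferentiableAt ℂ (cauchyTransform μ h) z := by
  -- Points within `δ/2` of `z` stay at distance at least `δ/2` from `K`, which dominates the
  -- differentiated kernel uniformly.
  obtain ⟨δ, hδ, hball⟩ := Metric.isOpen_iff.1 hK.isOpen_compl z hz
  have hfar : ∀ x ∈ Metric.ball z (δ / 2), ∀ w ∈ K, δ / 2 ≤ ‖w - x‖ := fun x hx w hw => by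
    by_contra! hlt
    refine hball (a := w) ?_ hw
    have := dist_triangle w x z
    rw [Metric.mem_ball] at hx ⊢
    rw [← dist_eq_norm] at hlt
    linarith
  have hmeas : ∀ (x : ℂ) (k : ℕ), AEStronglyMeasurable (fun w => h w / (w - x) ^ k) μ := by
    intro x k
    refine hh.aestronglyMeasurable.div₀ ?_
    fun_prop
  refine (hasDerivAt_integral_of_dominated_loc_of_deriv_le (μ := μ) (𝕜 := ℂ)
    (F := fun x w => h w / (w - x)) (F' := fun x w => h w / (w - x) ^ 2)
    (bound := fun w => ‖h w‖ * ((δ / 2) ^ 2)⁻¹)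
    (Metric.ball_mem_nhds z (half_pos hδ)) ?_ ?_ (hmeas z 2) ?_ (hh.norm.mul_const _)
    ?_).2.differentiableAt
  · exact Eventually.of_forall fun x => by simpa using hmeas x 1
  · refine (hh.norm.mul_const (δ / 2)⁻¹).mono' (by simpa using hmeas z 1) ?_
    filter_upwards [hμK] with w hw
    rw [norm_div, div_eq_mul_inv]
    gcongr
    exact hfar z (Metric.mem_ball_self (half_pos hδ)) w hw
  · filter_upwards [hμK] with w hw x hx
    rw [norm_div, norm_pow, div_eq_mul_inv]
    gcongr
    exact hfar x hx w hw
  · filter_upwards [hμK] with w hw x hx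
    have hne : w - x ≠ 0 := fun h0 => by
      have := hfar x hx w hw
      rw [h0, norm_zero] at this
      linarith
    have hd := ((hasDerivAt_id x).const_sub w).inv hne
    convert! hd.const_mul (h w) using 1
    simp [div_eq_mul_inv]

theorem cauchyTransform_eq_zero_of_isPreconnected {μ : Measure ℂ} {h : ℂ → ℂ}
    (hh : Integrable h μ) {R : ℝ} (hR0 : 0 ≤ R) (hR : ∀ᵐ w ∂μ, ‖w‖ ≤ R)
    (hmom : ∀ n : ℕ, ∫ w, h w * w ^ n ∂μ = 0) {K : Set ℂ} (hK : IsClosed K)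
    (hμK : ∀ᵐ w ∂μ, w ∈ K) {U : Set ℂ} (hU : IsOpen U) (hUc : IsPreconnected U)
    (hUK : Disjoint U K) {z₀ : ℂ} (hz₀ : z₀ ∈ U) (hz₀R : R < ‖z₀‖) {z : ℂ} (hz : z ∈ U) :
    cauchyTransform μ h z = 0 := by
  have hd : DifferentiableOn ℂ (cauchyTransform μ h) U := fun x hx =>
    (differentiableAt_cauchyTransform hh hK hμK
      (disjoint_left.1 hUK hx)).differentiableWithinAt
  refine (hd.analyticOnNhd hU).eqOn_zero_of_preconnected_of_eventuallyEq_zero hUc hz₀ ?_ hz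
  filter_upwards [continuous_norm.continuousAt.eventually (lt_mem_nhds hz₀R)] with x hx
  exact cauchyTransform_eq_zero_of_lt_norm hh hR hmom hR0 hx

/-- The shear `z ↦ z + iY(Re z)` carries a half-plane onto this region. -/
theorem isPreconnected_im_gt {Y : ℝ → ℝ} (hY : Continuous Y) :
    IsPreconnected {z : ℂ | Y z.re < z.im} := by
  have h := (convex_halfSpace_im_gt 0).isPreconnected.image (fun z : ℂ => z + Y z.re * Complex.I)
    (by fun_prop)
  convert h using 1
  ext z
  refine ⟨fun hz => ⟨z - Y z.re * Complex.I, ?_, ?_⟩, ?_⟩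
  · simpa using hz
  · simp
  · rintro ⟨v, hv, rfl⟩
    simpa using hv

theorem isPreconnected_im_lt {Y : ℝ → ℝ} (hY : Continuous Y) :
    IsPreconnected {z : ℂ | z.im < Y z.re} := by
  have h := (convex_halfSpace_im_lt 0).isPreconnected.image (fun z : ℂ => z + Y z.re * Complex.I)
    (by fun_prop)
  convert h using 1
  ext z
  refine ⟨fun hz => ⟨z - Y z.re * Complex.I, ?_, ?_⟩, ?_⟩
  · simpa using hz
  · simp
  · rintro ⟨v, hv, rfl⟩
    simpa using hv

theorem cauchyTransform_eq_zero_off_graph {μ : Measure ℂ} {h : ℂ → ℂ}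
    (hh : Integrable h μ) {R : ℝ} (hR0 : 0 ≤ R) (hR : ∀ᵐ w ∂μ, ‖w‖ ≤ R)
    (hmom : ∀ n : ℕ, ∫ w, h w * w ^ n ∂μ = 0) {Y : ℝ → ℝ} (hY : Continuous Y)
    (hμY : ∀ᵐ w ∂μ, w.im = Y w.re) {z : ℂ} (hz : z.im ≠ Y z.re) :
    cauchyTransform μ h z = 0 := by
  have hK : IsClosed {w : ℂ | w.im = Y w.re} := isClosed_eq (by fun_prop) (by fun_prop)
  -- With this `c`, the points `-ic` and `ic` lie strictly below and above the graph, and both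
  -- outside the disc of radius `R`.
  set c : ℝ := |Y 0| + R + 1 with hc
  have hcpos : 0 < c := by positivity
  have hcR : R < c := by linarith [abs_nonneg (Y 0)]
  rcases hz.lt_or_gt with hlt | hgt
  · refine cauchyTransform_eq_zero_of_isPreconnected hh hR0 hR hmom hK hμY
      (isOpen_lt (by fun_prop) (by fun_prop)) (isPreconnected_im_lt hY)
      (disjoint_left.2 fun w hw => ne_of_lt hw) (z₀ := ((-c : ℝ) : ℂ) * Complex.I) ?_ ?_ hlt
    · have := neg_abs_le (Y 0)
      simp
      linarith
    · simpa [abs_of_pos hcpos] using hcR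
  · refine cauchyTransform_eq_zero_of_isPreconnected hh hR0 hR hmom hK hμY
      (isOpen_lt (by fun_prop) (by fun_prop)) (isPreconnected_im_gt hY)
      (disjoint_left.2 fun w hw => ne_of_gt hw) (z₀ := (c : ℂ) * Complex.I) ?_ ?_ hgt
    · have := le_abs_self (Y 0)
      simp
      linarith
    · simpa [abs_of_pos hcpos] using hcR

/-! ### From a vanishing Cauchy transform to a vanishing measure. -/

/-- Each vertical line meets the graph in a single point, so Fubini makes the graph null. -/
theorem ae_im_ne_graph {Y : ℝ → ℝ} (hY : Continuous Y) : ∀ᵐ z : ℂ, z.im ≠ Y z.re := by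
  have hm : MeasurableSet {p : ℝ × ℝ | p.2 = Y p.1} :=
    (isClosed_eq continuous_snd (by fun_prop)).measurableSet
  have h0 : ∀ᵐ p : ℝ × ℝ, p.2 ≠ Y p.1 := by
    rw [ae_iff]
    simp only [ne_eq, not_not]
    rw [Measure.volume_eq_prod, Measure.measure_prod_null hm]
    refine Eventually.of_forall fun x => ?_
    exact measure_mono_null (t := {Y x}) (fun v hv => hv) (by simp)
  exact Complex.volume_preserving_equiv_real_prod.quasiMeasurePreserving.ae h0

theorem integrable_prod_twoDbar_div_sub {μ : Measure ℂ} [SFinite μ] {h : ℂ → ℂ}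
    (hh : Integrable h μ) {R : ℝ} (hR : ∀ᵐ w ∂μ, ‖w‖ ≤ R) {g : ℂ → ℝ} (hg : ContDiff ℝ 1 g)
    (hs : HasCompactSupport g) :
    Integrable (fun p : ℂ × ℂ => twoDbar g p.2 * (h p.1 / (p.1 - p.2))) (μ.prod volume) := by
  obtain ⟨S, hS0, hS⟩ := exists_fderiv_eq_zero_of_lt_norm hs
  have hD0 : ∀ z, S < ‖z‖ → twoDbar g z = 0 := fun z hz => by simp [twoDbar, (hS z hz).2]
  have hDc : Continuous (twoDbar g) := continuous_twoDbar hg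
  obtain ⟨M, hM⟩ := hDc.bounded_above_of_compact_support
    (HasCompactSupport.intro (isCompact_closedBall (0 : ℂ) S) fun z hz => hD0 z (by simpa using hz))
  -- The radius `R + S` contains every `z - w` with `|w| ≤ R` and `|z| ≤ S`, so a translate of this
  -- integrable kernel dominates each slice.
  set k : ℂ → ℝ := (Metric.closedBall (0 : ℂ) (R + S)).indicator fun z => ‖z‖⁻¹ with hk
  have hki : Integrable k :=
    (integrableOn_inv_norm_closedBall _).integrable_indicator Metric.isClosed_closedBall.measurableSet
  have hM0 : 0 ≤ M := (norm_nonneg _).trans (hM 0)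
  have hk0 : ∀ z, 0 ≤ k z := fun z => indicator_nonneg (fun _ _ => by positivity) z
  have hkb : ∀ w, ‖w‖ ≤ R → ∀ z, ‖twoDbar g z * (h w / (w - z))‖ ≤ ‖h w‖ * (M * k (z - w)) := by
    intro w hw z
    rcases lt_or_ge S ‖z‖ with hz | hz
    · rw [hD0 z hz, zero_mul, norm_zero]
      exact mul_nonneg (norm_nonneg _) (mul_nonneg hM0 (hk0 _))
    · have hmem : z - w ∈ Metric.closedBall (0 : ℂ) (R + S) := by
        rw [mem_closedBall_zero_iff]
        linarith [norm_sub_le z w]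
      rw [hk, indicator_of_mem hmem, norm_mul, norm_div, norm_sub_rev w z, div_eq_mul_inv,
        mul_left_comm]
      gcongr
      exact hM z
  have hmeas : AEStronglyMeasurable (fun p : ℂ × ℂ => twoDbar g p.2 * (h p.1 / (p.1 - p.2)))
      (μ.prod volume) := by
    refine (hDc.comp continuous_snd).aestronglyMeasurable.mul
      (hh.aestronglyMeasurable.comp_fst.div₀ ?_)
    fun_prop
  have hslice : ∀ w, Integrable (fun z => ‖h w‖ * (M * k (z - w))) := fun w =>
    ((hki.comp_sub_right w).const_mul M).const_mul _
  have hslice' : ∀ᵐ w ∂μ, Integrable fun z => twoDbar g z * (h w / (w - z)) := by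
    filter_upwards [hR] with w hw
    refine (hslice w).mono' ?_ (Eventually.of_forall (hkb w hw))
    refine hDc.aestronglyMeasurable.mul (aestronglyMeasurable_const.div₀ ?_)
    fun_prop
  refine (integrable_prod_iff hmeas).2 ⟨hslice', ?_⟩
  refine (hh.norm.mul_const (M * ∫ z, k z)).mono' hmeas.norm.integral_prod_right' ?_
  filter_upwards [hR, hslice'] with w hw hi
  rw [Real.norm_of_nonneg (integral_nonneg fun z => norm_nonneg _)]
  refine (integral_mono hi.norm (hslice w) (hkb w hw)).trans_eq ?_
  rw [integral_const_mul, integral_const_mul, integral_sub_right_eq_self]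

/-- A complex measure on a bounded part of the graph of a continuous function vanishes
if all its moments do. -/
theorem ae_eq_zero_of_moments_eq_zero {μ : Measure ℂ} [SFinite μ] {h : ℂ → ℂ}
    (hh : Integrable h μ) {R : ℝ} (hR0 : 0 ≤ R) (hR : ∀ᵐ w ∂μ, ‖w‖ ≤ R)
    (hmom : ∀ n : ℕ, ∫ w, h w * w ^ n ∂μ = 0) {Y : ℝ → ℝ} (hY : Continuous Y)
    (hμY : ∀ᵐ w ∂μ, w.im = Y w.re) : ∀ᵐ w ∂μ, h w = 0 := by
  refine ae_eq_zero_of_integral_contDiff_smul_eq_zero hh.locallyIntegrable fun g hg hs => ?_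
  have hg1 : ContDiff ℝ 1 g := hg.of_le (by exact_mod_cast le_top)
  have hswap := integral_integral_swap
    (f := fun w z => twoDbar g z * (h w / (w - z))) (integrable_prod_twoDbar_div_sub hh hR hg1 hs)
  have hright : ∫ z, ∫ w, twoDbar g z * (h w / (w - z)) ∂μ = 0 := by
    refine integral_eq_zero_of_ae ?_
    filter_upwards [ae_im_ne_graph hY] with z hz
    rw [integral_const_mul]
    change _ * cauchyTransform μ h z = 0
    rw [cauchyTransform_eq_zero_off_graph hh hR0 hR hmom hY hμY hz, mul_zero]
  -- The kernel is `1/(w - z)` here but `1/(z - w)` in Cauchy–Pompeiu; this sign cancels the minus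
  -- in that formula.
  have hleft : ∀ w, ∫ z, twoDbar g z * (h w / (w - z)) = (2 * Real.pi : ℂ) * (g w • h w) := by
    intro w
    have h1 : ∀ z, twoDbar g z * (h w / (w - z)) = -h w * (twoDbar g z / (z - w)) := fun z => by
      rw [← neg_sub z w, div_neg]
      ring
    simp only [h1]
    rw [integral_const_mul, integral_twoDbar_div_sub hg1 hs, Complex.real_smul]
    push_cast
    ring
  rw [hright] at hswap
  simp only [hleft] at hswap
  rw [integral_const_mul] at hswap
  refine (mul_eq_zero.1 hswap).resolve_left ?_
  exact_mod_cast (by positivity : (2 * Real.pi : ℝ) ≠ 0)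

end CauchyTransform

/-! ### Density of polynomials in `L²`. -/

theorem memLp_polynomial_eval {μ : Measure ℂ} [IsFiniteMeasure μ] {R : ℝ}
    (hR : ∀ᵐ w ∂μ, ‖w‖ ≤ R) (p : ℝ≥0∞) (P : ℂ[X]) : MemLp (fun z => P.eval z) p μ := by
  obtain ⟨C, hC⟩ := (isCompact_closedBall (0 : ℂ) R).exists_bound_of_continuousOn
    (f := fun z => P.eval z) P.continuous.continuousOn
  refine MemLp.of_bound P.continuous.aestronglyMeasurable C ?_
  filter_upwards [hR] with w hw
  exact hC w (by simpa using hw)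

/-- The subspace of polynomials in `L²(μ)`. -/
def polynomialSubmodule (μ : Measure ℂ) : Submodule ℂ (Lp ℂ 2 μ) where
  carrier := {f | ∃ P : ℂ[X], f =ᵐ[μ] fun z => P.eval z}
  add_mem' := by
    rintro f g ⟨P, hP⟩ ⟨Q, hQ⟩
    refine ⟨P + Q, ?_⟩
    filter_upwards [Lp.coeFn_add f g, hP, hQ] with z h1 h2 h3
    exact h1.trans (by simp [h2, h3])
  zero_mem' := ⟨0, by
    filter_upwards [Lp.coeFn_zero ℂ 2 μ] with z h
    exact h.trans (by simp)⟩
  smul_mem' := by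
    rintro c f ⟨P, hP⟩
    refine ⟨Polynomial.C c * P, ?_⟩
    filter_upwards [Lp.coeFn_smul c f, hP] with z h1 h2
    exact h1.trans (by simp [h2])

theorem dense_polynomials_of_graph {μ : Measure ℂ} [IsFiniteMeasure μ] {R : ℝ} (hR0 : 0 ≤ R)
    (hR : ∀ᵐ w ∂μ, ‖w‖ ≤ R) {Y : ℝ → ℝ} (hY : Continuous Y) (hμY : ∀ᵐ w ∂μ, w.im = Y w.re) :
    Dense {f : Lp ℂ 2 μ | ∃ P : ℂ[X], f =ᵐ[μ] fun z => P.eval z} := by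
  change Dense (polynomialSubmodule μ : Set (Lp ℂ 2 μ))
  rw [Submodule.dense_iff_topologicalClosure_eq_top, Submodule.topologicalClosure_eq_top_iff,
    Submodule.eq_bot_iff]
  intro f hf
  have hfi : Integrable f μ := (Lp.memLp f).integrable one_le_two
  -- The inner product is conjugate-linear in its first slot, so orthogonality to `zⁿ` is a moment
  -- condition on the conjugate of `f`.
  have hh : Integrable (fun w => (starRingEnd ℂ) (f w)) μ :=
    Complex.conjLIE.toContinuousLinearEquiv.toContinuousLinearMap.integrable_comp hfi
  have hmom : ∀ n : ℕ, ∫ w, (starRingEnd ℂ) (f w) * w ^ n ∂μ = 0 := fun n => by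
    have hm := memLp_polynomial_eval hR 2 (Polynomial.X ^ n : ℂ[X])
    have h0 := (Submodule.mem_orthogonal' _ f).1 hf (hm.toLp _) ⟨_, hm.coeFn_toLp⟩
    rw [L2.inner_def] at h0
    rw [← h0]
    refine integral_congr_ae ?_
    filter_upwards [hm.coeFn_toLp] with w hw
    rw [hw]
    simp [mul_comm]
  rw [Lp.eq_zero_iff_ae_eq_zero]
  filter_upwards [ae_eq_zero_of_moments_eq_zero hh hR0 hR hmom hY hμY] with w hw
  simpa using hw

theorem continuousOn_graphParam {a b : ℝ} {y : ℝ → ℝ} (hy : ContinuousOn y (Icc a b)) :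
    ContinuousOn (graphParam y) (Icc a b) :=
  Complex.equivRealProdCLM.symm.continuous.comp_continuousOn (continuousOn_id.prodMk hy)

theorem ae_mem_graph_weightedArcMeasure {a b : ℝ} {y : ℝ → ℝ} (hy : ContinuousOn y (Icc a b))
    (φ : ℂ → EReal) : ∀ᵐ w ∂weightedArcMeasure y a b φ, w ∈ graphParam y '' Icc a b := by
  have hg := continuousOn_graphParam hy
  refine (withDensity_absolutelyContinuous _ _).ae_le ?_
  have hac : (volume.restrict (Icc a b)).withDensity
      (fun t => ENNReal.ofReal (Real.sqrt (1 + deriv y t ^ 2))) ≪ volume.restrict (Icc a b) :=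
    withDensity_absolutelyContinuous _ _
  -- Nothing is known of `y` off `[a, b]`, so `graphParam y` is only a.e. measurable for the
  -- restricted measure; its image of `[a, b]` is compact, hence measurable.
  refine (ae_map_iff ((hg.aemeasurable measurableSet_Icc).mono_ac hac)
    (isCompact_Icc.image_of_continuousOn hg).measurableSet).2 (hac.ae_le ?_)
  filter_upwards [ae_restrict_mem measurableSet_Icc] with t ht
  exact mem_image_of_mem _ ht

theorem mainTheorem6 (a b : ℝ) (hab : a ≤ b) (y : ℝ → ℝ) (L : ℝ≥0)
    (hy : LipschitzOnWith L y (Icc a b)) (φ : ℂ → EReal)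
    (hφ : AEMeasurable φ (arcLengthMeasure y a b))
    (hint : ∫⁻ z, expNeg φ z ∂(arcLengthMeasure y a b) < ∞) :
    (∀ P : ℂ[X], MemLp (fun z => P.eval z) 2 (weightedArcMeasure y a b φ)) ∧
    Dense {f : Lp ℂ 2 (weightedArcMeasure y a b φ) |
      ∃ P : ℂ[X], f =ᵐ[weightedArcMeasure y a b φ] fun z => P.eval z} := by
  have : IsFiniteMeasure (weightedArcMeasure y a b φ) :=
    isFiniteMeasure_withDensity hint.ne
  obtain ⟨R, hR0, hR⟩ := (isCompact_Icc.image_of_continuousOn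
    (continuousOn_graphParam hy.continuousOn)).isBounded.exists_pos_norm_le
  have hmem := ae_mem_graph_weightedArcMeasure hy.continuousOn φ
  have hbound : ∀ᵐ w ∂weightedArcMeasure y a b φ, ‖w‖ ≤ R := hmem.mono hR
  refine ⟨memLp_polynomial_eval hbound 2, dense_polynomials_of_graph hR0.le hbound
    -- Extending `y` by its endpoint values gives a graph over all of `ℝ`, which splits the plane
    -- into an upper and a lower region.
    (Y := IccExtend hab ((Icc a b).domRestrict y)) ?_ ?_⟩
  · exact (continuousOn_iff_continuous_domRestrict.1 hy.continuousOn).Icc_extend'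
  · filter_upwards [hmem]
    rintro _ ⟨t, ht, rfl⟩
    simp [graphParam, IccExtend_of_mem hab _ ht]
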